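/- Let $m:\mathbb R\to\mathbb R$ be $C^1$ and nondecreasing with $m(x_2)\to m_\pm$ as $x_2\to\pm\infty$, where $m_+>0>m_-$. Let $\sigma_1,\sigma_2,\sigma_3$ be the Pauli matrices, $p_j=-\mathrm i\partial_j$, and consider on $\mathbb R^2$ the Dirac Hamiltonian $H=p_1\sigma_1+p_2\sigma_2+m(x_2)\sigma_3$ and the constant-mass Hamiltonians $H_\pm=p_1\sigma_1+p_2\sigma_2+m_\pm\sigma_3$. Put $\omega_\pm(k)=\sqrt{k_1^2+k_2^2+m_\pm^2}$, $e_\pm(k)=\omega_\pm(k)^{-1}(k_1,k_2,m_\pm)$ and $P_\pm(k)=\tfrac12(1+e_\pm(k)\cdot\sigma)$ for $k\in\mathbb R^2$. For a family $Q(k)$ of rank-one orthogonal projections on $\mathbb C^2$, write $E_Q=\bigsqcup_k\operatorname{ran}Q(k)$ and $$C\hbar(E_Q)=\frac1{2\pi \mathrm i}\int_{\mathbb R^2}\operatorname{tr}\bigl(Q[\partial_{k_1}Q,\partial_{k_2}Q]\bigr)\,dk_1dk_2 .$$ Let $\tilde{\mathbb D}=\mathbb D_+\cup\mathbb D_-$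 be two copies of the closed unit disk glued along their boundary circles by the identity. The plane is embedded in each copy by $k\mapsto k/\sqrt{1+|k|^2}$, so that boundary points are the directions at infinity. $\tilde{\mathbb D}$ is oriented so that $(k_1,k_2)$ is positively oriented on $\mathbb D_+$ and $(k_1,-k_2)$ is positively oriented on $\mathbb D_-$. The Chern number of a complex line bundle over $\tilde{\mathbb D}$ is the winding number of $g$ along the equator (counterclockwise in $\mathbb D_+$), where $s_+=g\,s_-$ there and $s_\pm$ are nowhere vanishing continuous sections over $\mathbb D_\pm$; this is the sign convention $Ch=\frac1{2\pi \mathrm i}\int\operatorname{tr}(P\,dP\wedge dP)$ for the bundle $\operatorname{ran}P$. Then: 1. $H_\pm$ are the asymptotic Hamiltonians of $H$: with $(T_a\psi)(x_1,x_2)=\psi(x_1,x_2-a)$, $\|(H-H_\pm)T_a\psi\|_{L^2}\to0$ as $a\to\pm\infty$ for every differentiable $\psi\in L^2(\mathbb R^2;\mathbb C^2)$. The Fourier symbol of $H_\pm$ is $H_\pm(k)=k_1\sigma_1+k_2\sigma_2+m_\pm\sigma_3$, and $P_\pm(k)$ is the rank-one orthogonal projection onto the eigenspace of $H_\pm(k)$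 with eigenvalue $\omega_\pm(k)$. 2. For every $\theta$, the limits of $P_+(r\cos\theta,r\sin\theta)$ and $P_-(r\cos\theta,r\sin\theta)$ as $r\to\infty$ exist and are equal. 3. Writing $E_\pm=E_{P_\pm}$, the integrals defining $C\hbar(E_\pm)$ converge absolutely and $$C\hbar(E_\pm)=\frac1{4\pi}\int_{\mathbb R^2}e_\pm\cdot(\partial_{k_1}e_\pm\wedge\partial_{k_2}e_\pm)\,dk_1dk_2=\tfrac12\operatorname{sgn}(m_\pm),$$ so $C\hbar(E_+)-C\hbar(E_-)=\tfrac12\operatorname{sgn}(m_+)-\tfrac12\operatorname{sgn}(m_-)=1$. 4. $\tilde{\mathbb D}$ is homeomorphic to $S^2$. There is exactly one continuous matrix-valued function $P$ on $\tilde{\mathbb D}$ that restricts to $P_\pm$ on the plane in $\mathbb D_\pm$. All $P(q)$ are rank-one orthogonal projections, and $E=\{(q,\psi):\psi\in\operatorname{ran}P(q)\}\subset\tilde{\mathbb D}\times\mathbb C^2$ is a complex line bundle over $\tilde{\mathbb D}$. 5. The bulk index $Ch(E)$ of $H$ is well defined (independent of the choice of the sections $s_\pm$ and of the logarithm of $g$),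 is the same for every bundle isomorphic to $E$, and $$Ch(E)=C\hbar(E_+)-C\hbar(E_-)=1.$$ It also equals the Chern integral $\frac1{2\pi \mathrm i}\int\operatorname{tr}(P[\partial_{q_1}P,\partial_{q_2}P])\,dq_1dq_2$ over $\tilde{\mathbb D}$, evaluated in the oriented charts $(k_1,k_2)$ of the interior of $\mathbb D_+$ and $(k_1,-k_2)$ of the interior of $\mathbb D_-$. -/

import Mathlib

open Filter Topology MeasureTheory Bundle

/-- Complex `2 × 2` matrices. -/
abbrev Mat2 : Type := Matrix (Fin 2) (Fin 2) ℂ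

/-- The Pauli matrices. -/
def pauli1 : Mat2 := !![0, 1; 1, 0]
def pauli2 : Mat2 := !![0, -Complex.I; Complex.I, 0]
def pauli3 : Mat2 := !![1, 0; 0, -1]

section Hamiltonian

/-- Spinors on the plane. -/
abbrev Spinor : Type := ℝ × ℝ → Fin 2 → ℂ

/-- The Dirac differential expression `(p₁, p₂, M(x₂)) · σ`, with `p_j = -i ∂_j`. -/
noncomputable def diracOp (M : ℝ → ℝ) (ψ : Spinor) : Spinor := fun x =>
  pauli1.mulVec (-Complex.I • deriv (fun t : ℝ => ψ (t, x.2)) x.1)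
    + pauli2.mulVec (-Complex.I • deriv (fun t : ℝ => ψ (x.1, t)) x.2)
    + (M x.2 : ℂ) • pauli3.mulVec (ψ x)

/-- The `L²` norm of a spinor, with the Hermitian norm on `ℂ²`. -/
noncomputable def spinorNorm (ψ : Spinor) : ENNReal :=
  eLpNorm (fun x => (WithLp.toLp 2 (ψ x) : EuclideanSpace ℂ (Fin 2))) 2 volume

/-- Square integrable spinors. -/
def SpinorL2 (ψ : Spinor) : Prop :=
  MemLp (fun x => (WithLp.toLp 2 (ψ x) : EuclideanSpace ℂ (Fin 2))) 2 volume

/-- The translation `T_a = exp (-i p₂ a)`. -/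
def translateX2 (a : ℝ) (ψ : Spinor) : Spinor := fun x => ψ (x.1, x.2 - a)

/-- `(H - H') T_a → 0` strongly as `a` tends along `l`. -/
def IsAsymptoticHamiltonian (H H' : Spinor → Spinor) (l : Filter ℝ) : Prop :=
  ∀ ψ : Spinor, Differentiable ℝ ψ → SpinorL2 ψ →
    Tendsto (fun a => spinorNorm (H (translateX2 a ψ) - H' (translateX2 a ψ))) l (𝓝 0)

/-- The plane wave `x ↦ exp (i k·x) v`. -/
noncomputable def planeWave (k : ℝ × ℝ) (v : Fin 2 → ℂ) : Spinor := fun x =>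
  Complex.exp (Complex.I * ((k.1 * x.1 + k.2 * x.2 : ℝ) : ℂ)) • v

/-- `S` is the Fourier symbol of the translation invariant operator `H`. -/
def IsFourierSymbol (H : Spinor → Spinor) (S : ℝ × ℝ → Mat2) : Prop :=
  ∀ (k : ℝ × ℝ) (v : Fin 2 → ℂ), H (planeWave k v) = planeWave k ((S k).mulVec v)

/-- The Bloch Hamiltonian `(k₁, k₂, M) · σ`. -/
noncomputable def diracSymbol (M : ℝ) (k : ℝ × ℝ) : Mat2 :=
  (k.1 : ℂ) • pauli1 + (k.2 : ℂ) • pauli2 + (M : ℂ) • pauli3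

/-- The dispersion relation `ω(k) = √(k₁² + k₂² + M²)`. -/
noncomputable def dispersion (M : ℝ) (k : ℝ × ℝ) : ℝ :=
  Real.sqrt (k.1 ^ 2 + k.2 ^ 2 + M ^ 2)

/-- The unit vector `e(k) = (k₁, k₂, M) / ω(k)`. -/
noncomputable def blochVec (M : ℝ) (k : ℝ × ℝ) : Fin 3 → ℝ :=
  ![k.1 / dispersion M k, k.2 / dispersion M k, M / dispersion M k]

/-- The projection `P(k) = (1 + e(k) · σ) / 2`. -/
noncomputable def bandProj (M : ℝ) (k : ℝ × ℝ) : Mat2 :=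
  (1 / 2 : ℂ) • (1 + (blochVec M k 0 : ℂ) • pauli1 + (blochVec M k 1 : ℂ) • pauli2
    + (blochVec M k 2 : ℂ) • pauli3)

/-- `A` is an orthogonal projection of rank one. -/
def IsLineProj (A : Mat2) : Prop :=
  A.IsHermitian ∧ A * A = A ∧ Module.finrank ℂ (LinearMap.range (Matrix.toLin' A)) = 1

/-- `P(k)` is the orthogonal projection onto the eigenline of `S(k)` with eigenvalue `ω(k)`. -/
def IsBandProjection (S : ℝ × ℝ → Mat2) (ω : ℝ × ℝ → ℝ) (P : ℝ × ℝ → Mat2) : Prop :=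
  ∀ k, IsLineProj (P k) ∧
    LinearMap.range (Matrix.toLin' (P k))
      = Module.End.eigenspace (Matrix.toLin' (S k)) (ω k : ℂ)

end Hamiltonian

section Curvature

/-- Partial derivatives (entrywise) of a matrix valued function on the plane. -/
noncomputable def matD1 (Q : ℝ × ℝ → Mat2) (k : ℝ × ℝ) : Mat2 :=
  Matrix.of fun i j => deriv (fun t : ℝ => Q (t, k.2) i j) k.1
noncomputable def matD2 (Q : ℝ × ℝ → Mat2) (k : ℝ × ℝ) : Mat2 :=
  Matrix.of fun i j => deriv (fun t : ℝ => Q (k.1, t) i j) k.2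

/-- The Chern density `(2πi)⁻¹ tr (Q [∂₁Q, ∂₂Q])` of a family of projections. -/
noncomputable def chernDensity (Q : ℝ × ℝ → Mat2) (k : ℝ × ℝ) : ℂ :=
  (2 * (Real.pi : ℂ) * Complex.I)⁻¹ *
    (Q k * (matD1 Q k * matD2 Q k - matD2 Q k * matD1 Q k)).trace

/-- The formal Chern number of the family of lines `ran Q(k)` over the non-compact plane. -/
noncomputable def formalChern (Q : ℝ × ℝ → Mat2) : ℂ := ∫ k, chernDensity Q k

/-- `e · (∂₁e ∧ ∂₂e)`. -/
noncomputable def solidAngleDensity (e : ℝ × ℝ → Fin 3 → ℝ) (k : ℝ × ℝ) : ℝ :=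
  dotProduct (e k)
    (crossProduct (deriv (fun t : ℝ => e (t, k.2)) k.1) (deriv (fun t : ℝ => e (k.1, t)) k.2))

end Curvature

section BrillouinZone

/-- The closed unit disk. -/
abbrev ClosedDisk : Type := {p : ℝ × ℝ // p.1 ^ 2 + p.2 ^ 2 ≤ 1}

/-- The radial compactification `k ↦ k / √(1 + |k|²)` of the plane, a homeomorphism onto the open
disk; the boundary point `(cos θ, sin θ)` is the point at infinity in direction `θ`. -/
noncomputable def toDisk (k : ℝ × ℝ) : ClosedDisk :=
  ⟨(k.1 / Real.sqrt (1 + k.1 ^ 2 + k.2 ^ 2), k.2 / Real.sqrt (1 + k.1 ^ 2 + k.2 ^ 2)), by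
    have h : 0 < 1 + k.1 ^ 2 + k.2 ^ 2 := by positivity
    simp only [div_pow, Real.sq_sqrt h.le]
    rw [← add_div, div_le_one h]
    linarith⟩

/-- The point at infinity in direction `θ`. -/
noncomputable def diskBoundary (θ : ℝ) : ClosedDisk :=
  ⟨(Real.cos θ, Real.sin θ), (Real.cos_sq_add_sin_sq θ).le⟩

/-- Identification of the boundary points of two copies of the closed disk. -/
inductive GlueRel : ClosedDisk ⊕ ClosedDisk → ClosedDisk ⊕ ClosedDisk → Prop
  | boundary (p : ClosedDisk) (h : p.1.1 ^ 2 + p.1.2 ^ 2 = 1) : GlueRel (Sum.inl p) (Sum.inr p)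

/-- The compactified Brillouin zone: two closed disks joined along their boundary circles. It is
oriented so that the inclusion of the first disk preserves, and that of the second disk reverses,
the orientation given by the coordinates `(k₁, k₂)`. -/
def CompactBZ : Type := Quot GlueRel

instance : TopologicalSpace CompactBZ := inferInstanceAs (TopologicalSpace (Quot GlueRel))

/-- The inclusions of the two disks. -/
def inclPlus (p : ClosedDisk) : CompactBZ := Quot.mk _ (Sum.inl p)
def inclMinus (p : ClosedDisk) : CompactBZ := Quot.mk _ (Sum.inr p)

/-- The common boundary circle, run through counterclockwise as seen in the first disk. -/
noncomputable def equator (θ : ℝ) : CompactBZ := inclPlus (diskBoundary θ)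

/-- The Chern integral `(2πi)⁻¹ ∫ tr (P [∂₁P, ∂₂P])` over the oriented sphere, evaluated in the
positively oriented chart `(k₁, k₂)` of the first open disk and the positively oriented chart
`(k₁, -k₂)` of the second one; together they cover all but the equator. -/
noncomputable def chernIntegral (P : CompactBZ → Mat2) : ℂ :=
  formalChern (fun k => P (inclPlus (toDisk k)))
    + formalChern (fun k => P (inclMinus (toDisk (k.1, -k.2))))

end BrillouinZone

section LineBundle

/-- The fiber `ran P(q)`. -/
def BandFiber {B : Type*} (P : B → Mat2) (q : B) : Type :=
  LinearMap.range (Matrix.toLin' (P q))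

variable {B : Type*} (P : B → Mat2)

instance (q : B) : AddCommGroup (BandFiber P q) :=
  inferInstanceAs (AddCommGroup (LinearMap.range (Matrix.toLin' (P q))))
instance (q : B) : Module ℂ (BandFiber P q) :=
  inferInstanceAs (Module ℂ (LinearMap.range (Matrix.toLin' (P q))))
instance (q : B) : TopologicalSpace (BandFiber P q) :=
  inferInstanceAs (TopologicalSpace (LinearMap.range (Matrix.toLin' (P q))))

/-- The vector of `ℂ²` underlying a point of the fiber. -/
def BandFiber.vec {B : Type*} {P : B → Mat2} {q : B} (v : BandFiber P q) : Fin 2 → ℂ := v.1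

/-- The total space `{(q, ψ) | ψ ∈ ran P(q)}` carries the subspace topology of `B × ℂ²`. -/
noncomputable instance [TopologicalSpace B] :
    TopologicalSpace (TotalSpace ℂ (BandFiber P)) :=
  TopologicalSpace.induced (fun v => (v.proj, v.snd.vec)) inferInstance

/-- `n` is the Chern number of the complex line bundle `E` over the oriented sphere: for continuous
nowhere vanishing sections `s₊`, `s₋` over the two closed disks, the transition function `g` in
`s₊ = g s₋` on the equator has winding number `n` (here `g = exp φ` with a continuous `φ`).
In the sign convention `Ch = (2πi)⁻¹ ∫ tr (P dP ∧ dP)` for `E = ran P`. -/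
def IsChernNumber (E : CompactBZ → Type*) [∀ q, AddCommGroup (E q)] [∀ q, Module ℂ (E q)]
    [TopologicalSpace (TotalSpace ℂ E)] (n : ℤ) : Prop :=
  ∃ sp sm : ∀ q, E q,
    ContinuousOn (fun q => TotalSpace.mk' ℂ q (sp q)) (Set.range inclPlus) ∧
    ContinuousOn (fun q => TotalSpace.mk' ℂ q (sm q)) (Set.range inclMinus) ∧
    (∀ q ∈ Set.range inclPlus, sp q ≠ 0) ∧
    (∀ q ∈ Set.range inclMinus, sm q ≠ 0) ∧
    ∃ φ : ℝ → ℂ, Continuous φ ∧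
      (∀ θ, sp (equator θ) = Complex.exp (φ θ) • sm (equator θ)) ∧
      φ (2 * Real.pi) - φ 0 = 2 * (Real.pi : ℂ) * Complex.I * (n : ℂ)

/-- The line bundles `E` and `L` over the sphere are isomorphic. -/
def LineBundleIso (E L : CompactBZ → Type*) [∀ q, AddCommGroup (E q)] [∀ q, Module ℂ (E q)]
    [∀ q, AddCommGroup (L q)] [∀ q, Module ℂ (L q)]
    [TopologicalSpace (TotalSpace ℂ E)] [TopologicalSpace (TotalSpace ℂ L)] : Prop :=
  ∃ f : ∀ q, E q ≃ₗ[ℂ] L q,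
    Continuous (fun v : TotalSpace ℂ E => TotalSpace.mk' ℂ v.proj (f v.proj v.snd)) ∧
    Continuous (fun v : TotalSpace ℂ L => TotalSpace.mk' ℂ v.proj ((f v.proj).symm v.snd))

end LineBundle

/-! ### Dirac operators, their symbols and band projections -/

section Hamiltonian

/-! The difference of $H$ and $H_\pm$ is multiplication by $(m-m_\pm)\sigma_3$. Translating the
spinor amounts to translating this bounded factor, which then tends to zero pointwise, and dominated
convergence gives the strong limit.

The Chern density of $\tfrac12(1+e\cdot\sigma)$ is $\tfrac1{4\pi}$ times the solid angle density of
$e$ (`chernDensity_blochProj`). For the Dirac symbol this is $M/(4\pi\omega^3)$, and $e$ sweeps out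
one hemisphere of signed area $2\pi\operatorname{sgn}M$. Hence each formal Chern number is a
half-integer, and the difference is 1.

As $|k|\to\infty$ the mass component of $e$ vanishes, so the extension of $P_\pm$ to the boundary
circle does not depend on the mass and the two projections glue (`diskVec_of_boundary`).

Over $\mathbb D_+$ one has $e_3\ge0$, so $P_{00}\ne0$ and the first column of $P$ is a frame; over
$\mathbb D_-$ the second column is one. On the equator the first column is $e^{i\theta}$ times the
second, with winding number 1 (`isChernNumber_gluedProj_one`). Any other sections differ from these
by nonvanishing functions on disks, whose boundary logarithms are periodic, so the winding number
does not change (`IsChernNumber.eq_one`).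

The equality of the index with the difference of formal Chern numbers is obtained by evaluating both
sides. The Chern integral equals that difference because the chart $(k_1,-k_2)$ reverses the sign of
the second term. -/

theorem diracOp_sub (M N : ℝ → ℝ) (ψ : Spinor) (x : ℝ × ℝ) :
    (diracOp M ψ - diracOp N ψ) x = ((M x.2 - N x.2 : ℝ) : ℂ) • pauli3.mulVec (ψ x) := by
  simp only [Pi.sub_apply, diracOp, Complex.ofReal_sub, sub_smul]
  abel

theorem norm_toLp_pauli3_mulVec (v : Fin 2 → ℂ) :
    ‖(WithLp.toLp 2 (pauli3.mulVec v) : EuclideanSpace ℂ (Fin 2))‖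
      = ‖(WithLp.toLp 2 v : EuclideanSpace ℂ (Fin 2))‖ := by
  simp [EuclideanSpace.norm_eq, pauli3, Fin.sum_univ_two, dotProduct]

/-- Dominated convergence for the squared integrand, with majorant $C^2\|f\|^2$. -/
theorem tendsto_eLpNorm_two_mul_zero {α ι F : Type*} [MeasurableSpace α] {μ : Measure α}
    [NormedAddCommGroup F] {l : Filter ι} [l.IsCountablyGenerated] {f : α → F} (hf : MemLp f 2 μ)
    {w : ι → α → ℝ} (hw : ∀ i, AEStronglyMeasurable (w i) μ) {C : ℝ} (hC : ∀ i x, |w i x| ≤ C)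
    (hlim : ∀ x, Tendsto (fun i => w i x) l (𝓝 0)) :
    Tendsto (fun i => eLpNorm (fun x => w i x * ‖f x‖) 2 μ) l (𝓝 0) := by
  have key : Tendsto (fun i => ∫⁻ x, ‖w i x * ‖f x‖‖ₑ ^ (2 : ℝ) ∂μ) l (𝓝 (∫⁻ _, 0 ∂μ)) := by
    refine tendsto_lintegral_filter_of_dominated_convergence'
      (fun x => ENNReal.ofReal C ^ (2 : ℝ) * ‖f x‖ₑ ^ (2 : ℝ)) (.of_forall fun i => ?_)
      (.of_forall fun i => .of_forall fun x => ?_) ?_ (.of_forall fun x => ?_)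
    · exact ((hw i).mul hf.1.norm).enorm.pow_const _
    · rw [← ENNReal.mul_rpow_of_nonneg _ _ (by norm_num), enorm_mul, enorm_norm]
      gcongr
      rw [Real.enorm_eq_ofReal_abs]
      exact ENNReal.ofReal_le_ofReal (hC i x)
    · have h2 := hf.2
      rw [eLpNorm_lt_top_iff_lintegral_rpow_enorm_lt_top (by norm_num) (by norm_num)] at h2
      rw [lintegral_const_mul' _ _ (by finiteness)]
      exact ENNReal.mul_ne_top (by finiteness) (by simpa using h2.ne)
    · have h : Tendsto (fun i => w i x * ‖f x‖) l (𝓝 0) := by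
        simpa using (hlim x).mul_const ‖f x‖
      have h' := (h.enorm).ennrpow_const 2
      simpa using h'
  have h2 := key.ennrpow_const (1 / 2)
  simp only [lintegral_zero] at h2
  rw [ENNReal.zero_rpow_of_pos (by norm_num)] at h2
  refine h2.congr fun i => ?_
  rw [eLpNorm_eq_lintegral_rpow_enorm_toReal (by norm_num) (by norm_num)]
  simp

/-- The translation invariance `hl` of the filter lets one argument serve both ends of the line. -/
theorem isAsymptoticHamiltonian_diracOp {m : ℝ → ℝ} (hm : Continuous m) {c C : ℝ}
    (hC : ∀ x, |m x - c| ≤ C) {l : Filter ℝ} [l.IsCountablyGenerated] (hc : Tendsto m l (𝓝 c))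
    (hl : ∀ s : ℝ, Tendsto (fun a => s + a) l l) :
    IsAsymptoticHamiltonian (diracOp m) (diracOp fun _ => c) l := by
  intro ψ hψ hψ2
  have hcont : Continuous fun x => (WithLp.toLp 2 (ψ x) : EuclideanSpace ℂ (Fin 2)) :=
    (PiLp.continuous_toLp 2 _).comp hψ.continuous
  have hw : ∀ a : ℝ, Continuous fun y : ℝ × ℝ => m (y.2 + a) - c := fun a => by fun_prop
  have key := tendsto_eLpNorm_two_mul_zero (l := l) hψ2 (C := C)
    (w := fun a y => m (y.2 + a) - c) (fun a => (hw a).aestronglyMeasurable)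
    (fun a x => hC _) fun x => by simpa using (hc.comp (hl x.2)).sub_const c
  refine key.congr fun a => ?_
  -- Invariance of Lebesgue measure moves the translation from the spinor to the mass.
  have hT : MeasurePreserving (fun x : ℝ × ℝ => x - (0, a)) volume volume :=
    measurePreserving_sub_right volume (0, a)
  have hcomp := eLpNorm_comp_measurePreserving (p := 2)
    (((hw a).mul hcont.norm).aestronglyMeasurable) hT
  refine hcomp.symm.trans ?_
  rw [spinorNorm]
  refine eLpNorm_congr_norm_ae (.of_forall fun x => ?_)
  simp only [diracOp_sub, WithLp.toLp_smul, norm_smul, norm_toLp_pauli3_mulVec]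
  have hx : x - (0, a) = (x.1, x.2 - a) := Prod.ext (sub_zero _) rfl
  simp [translateX2, hx, -Complex.ofReal_sub]

theorem deriv_exp_smul (a b t : ℝ) (v : Fin 2 → ℂ) :
    deriv (fun t : ℝ => Complex.exp (Complex.I * ((a * t + b : ℝ) : ℂ)) • v) t
      = (Complex.I * a) • (Complex.exp (Complex.I * ((a * t + b : ℝ) : ℂ)) • v) := by
  have h1 : HasDerivAt (fun t : ℝ => a * t + b) a t := by
    simpa using ((hasDerivAt_id t).const_mul a).add_const b
  have h := (((h1.ofReal_comp).const_mul Complex.I).cexp).smul_const v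
  rw [h.deriv, smul_smul]
  congr 1
  ring

theorem isFourierSymbol_diracOp (M : ℝ) :
    IsFourierSymbol (diracOp fun _ => M) (diracSymbol M) := by
  intro k v
  funext x
  have h1 : deriv (fun t : ℝ => planeWave k v (t, x.2)) x.1
      = (Complex.I * k.1) • planeWave k v x := deriv_exp_smul k.1 (k.2 * x.2) x.1 v
  have h2 : deriv (fun t : ℝ => planeWave k v (x.1, t)) x.2
      = (Complex.I * k.2) • planeWave k v x := by
    have := deriv_exp_smul k.2 (k.1 * x.1) x.2 v
    simpa only [planeWave, add_comm (k.1 * x.1)] using this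
  have hI : ∀ a : ℂ, -Complex.I * (Complex.I * a) = a := fun a => by
    rw [← mul_assoc, neg_mul, Complex.I_mul_I, neg_neg, one_mul]
  simp only [diracOp, h1, h2, smul_smul, hI, Matrix.mulVec_smul]
  ext i
  fin_cases i <;> simp [planeWave, diracSymbol, pauli1, pauli2, pauli3, dotProduct,
    Fin.sum_univ_two] <;> ring

theorem dispersion_sq (M : ℝ) (k : ℝ × ℝ) : dispersion M k ^ 2 = k.1 ^ 2 + k.2 ^ 2 + M ^ 2 :=
  Real.sq_sqrt (by positivity)

theorem dispersion_pos {M : ℝ} (hM : M ≠ 0) (k : ℝ × ℝ) : 0 < dispersion M k :=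
  Real.sqrt_pos.2 (by positivity)

/-- The matrix `(1 + e · σ) / 2`. -/
noncomputable def blochProj (e : Fin 3 → ℝ) : Mat2 :=
  (1 / 2 : ℂ) • (1 + (e 0 : ℂ) • pauli1 + (e 1 : ℂ) • pauli2 + (e 2 : ℂ) • pauli3)

theorem bandProj_eq (M : ℝ) (k : ℝ × ℝ) : bandProj M k = blochProj (blochVec M k) := rfl

theorem blochProj_eq (e : Fin 3 → ℝ) :
    blochProj e = !![(1 + e 2 : ℂ) / 2, ((e 0 : ℂ) - e 1 * Complex.I) / 2;
      ((e 0 : ℂ) + e 1 * Complex.I) / 2, (1 - e 2 : ℂ) / 2] := by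
  ext i j
  fin_cases i <;> fin_cases j <;> simp [blochProj, pauli1, pauli2, pauli3] <;> ring

theorem isHermitian_blochProj (e : Fin 3 → ℝ) : (blochProj e).IsHermitian := by
  rw [blochProj_eq]
  ext i j
  fin_cases i <;> fin_cases j <;> simp [Matrix.conjTranspose_apply] <;> ring

theorem trace_blochProj (e : Fin 3 → ℝ) : (blochProj e).trace = 1 := by
  rw [blochProj_eq]
  simp [Matrix.trace_fin_two]
  ring

theorem blochProj_mul_self {e : Fin 3 → ℝ} (he : e 0 ^ 2 + e 1 ^ 2 + e 2 ^ 2 = 1) :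
    blochProj e * blochProj e = blochProj e := by
  have he' : (e 0 : ℂ) ^ 2 + (e 1 : ℂ) ^ 2 + (e 2 : ℂ) ^ 2 = 1 := by exact_mod_cast he
  rw [blochProj_eq]
  ext i j
  fin_cases i <;> fin_cases j <;> simp [Matrix.mul_apply, Fin.sum_univ_two]
  · linear_combination he' / 4 - (e 1 : ℂ) ^ 2 / 4 * Complex.I_sq
  · ring
  · ring
  · linear_combination he' / 4 - (e 1 : ℂ) ^ 2 / 4 * Complex.I_sq

theorem det_blochProj {e : Fin 3 → ℝ} (he : e 0 ^ 2 + e 1 ^ 2 + e 2 ^ 2 = 1) :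
    (blochProj e).det = 0 := by
  have he' : (e 0 : ℂ) ^ 2 + (e 1 : ℂ) ^ 2 + (e 2 : ℂ) ^ 2 = 1 := by exact_mod_cast he
  rw [blochProj_eq, Matrix.det_fin_two]
  simp
  linear_combination - he' / 4 + (e 1 : ℂ) ^ 2 / 4 * Complex.I_sq

/-- Determinant 0 excludes rank two, and trace 1 excludes rank zero. -/
theorem isLineProj_blochProj {e : Fin 3 → ℝ} (he : e 0 ^ 2 + e 1 ^ 2 + e 2 ^ 2 = 1) :
    IsLineProj (blochProj e) := by
  refine ⟨isHermitian_blochProj e, blochProj_mul_self he, le_antisymm ?_ ?_⟩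
  · have hlt : LinearMap.range (Matrix.toLin' (blochProj e)) < ⊤ := by
      rw [lt_top_iff_ne_top]
      intro h
      have h2 := LinearMap.range_eq_top.1 h
      have h3 : Function.Surjective (blochProj e).mulVec := h2
      rw [Matrix.mulVec_surjective_iff_isUnit, Matrix.isUnit_iff_isUnit_det, det_blochProj he] at h3
      exact not_isUnit_zero h3
    have := Submodule.finrank_lt_finrank_of_lt hlt
    rw [finrank_top, Module.finrank_fin_fun] at this
    omega
  · rw [Nat.one_le_iff_ne_zero]
    intro h
    have h1 := Submodule.finrank_eq_zero.1 h
    rw [LinearMap.range_eq_bot, LinearEquiv.map_eq_zero_iff] at h1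
    have := trace_blochProj e
    rw [h1] at this
    simp at this

theorem blochVec_sq {M : ℝ} (hM : M ≠ 0) (k : ℝ × ℝ) :
    blochVec M k 0 ^ 2 + blochVec M k 1 ^ 2 + blochVec M k 2 ^ 2 = 1 := by
  have h := dispersion_pos hM k
  have h2 := dispersion_sq M k
  simp only [blochVec, Matrix.cons_val]
  field_simp
  exact h2.symm

theorem isBandProjection_bandProj {M : ℝ} (hM : M ≠ 0) :
    IsBandProjection (diracSymbol M) (dispersion M) (bandProj M) := by
  intro k
  have hP := isLineProj_blochProj (blochVec_sq hM k)
  rw [← bandProj_eq] at hP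
  refine ⟨hP, ?_⟩
  have hω : (dispersion M k : ℂ) ≠ 0 := by exact_mod_cast (dispersion_pos hM k).ne'
  -- Since $S=\omega(2P-1)$ with $\omega\neq0$, the equation $Sv=\omega v$ is equivalent to $Pv=v$.
  have hS : diracSymbol M k = (dispersion M k : ℂ) • ((2 : ℂ) • bandProj M k - 1) := by
    ext i j
    fin_cases i <;> fin_cases j <;>
      simp [bandProj, blochVec, diracSymbol, pauli1, pauli2, pauli3] <;> field_simp
  ext v
  rw [Module.End.mem_eigenspace_iff, hS]
  simp only [LinearMap.mem_range, Matrix.toLin'_apply, Matrix.smul_mulVec, Matrix.sub_mulVec,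
    Matrix.one_mulVec]
  constructor
  · rintro ⟨w, rfl⟩
    rw [Matrix.mulVec_mulVec, hP.2.1, two_smul, add_sub_cancel_right]
  · intro h
    refine ⟨v, ?_⟩
    have h1 := smul_right_injective (Fin 2 → ℂ) hω h
    rw [sub_eq_iff_eq_add, ← two_smul ℂ v] at h1
    exact smul_right_injective (Fin 2 → ℂ) (two_ne_zero (α := ℂ)) h1

end Hamiltonian

/-! ### Chern densities and formal Chern numbers -/

section Curvature

/-- `blochProj` is affine; subtracting its value at 0 leaves the linear part. -/
theorem HasDerivAt.blochProj_apply {f : ℝ → Fin 3 → ℝ} {d : Fin 3 → ℝ} {t : ℝ}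
    (h : HasDerivAt f d t) (i j : Fin 2) :
    HasDerivAt (fun s => blochProj (f s) i j) ((blochProj d - blochProj 0) i j) t := by
  have h0 := ((hasDerivAt_pi.1 h) 0).ofReal_comp
  have h1 := ((hasDerivAt_pi.1 h) 1).ofReal_comp
  have h2 := ((hasDerivAt_pi.1 h) 2).ofReal_comp
  simp only [blochProj_eq]
  fin_cases i <;> fin_cases j <;>
    simp only [Matrix.sub_apply, Matrix.of_apply, Matrix.cons_val', Matrix.cons_val,
      Fin.zero_eta, Fin.mk_one, Fin.isValue]
  · exact ((h2.const_add 1).div_const 2).congr_deriv (by simp; ring)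
  · exact ((h0.sub (h1.mul_const Complex.I)).div_const 2).congr_deriv (by simp)
  · exact ((h0.add (h1.mul_const Complex.I)).div_const 2).congr_deriv (by simp)
  · exact ((h2.const_sub 1).div_const 2).congr_deriv (by simp; ring)

theorem chernDensity_blochProj {e : ℝ × ℝ → Fin 3 → ℝ} {k : ℝ × ℝ} {d₁ d₂ : Fin 3 → ℝ}
    (h₁ : HasDerivAt (fun t => e (t, k.2)) d₁ k.1) (h₂ : HasDerivAt (fun t => e (k.1, t)) d₂ k.2) :
    chernDensity (fun k => blochProj (e k)) k
      = ((1 / (4 * Real.pi) * solidAngleDensity e k : ℝ) : ℂ) := by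
  have hD1 : matD1 (fun k => blochProj (e k)) k = blochProj d₁ - blochProj 0 := by
    ext i j
    exact (h₁.blochProj_apply i j).deriv
  have hD2 : matD2 (fun k => blochProj (e k)) k = blochProj d₂ - blochProj 0 := by
    ext i j
    exact (h₂.blochProj_apply i j).deriv
  have hπ : (Real.pi : ℂ) ≠ 0 := by exact_mod_cast Real.pi_ne_zero
  rw [chernDensity, solidAngleDensity, h₁.deriv, h₂.deriv, hD1, hD2]
  -- Pauli algebra: the commutator of $\tfrac12 d_1\cdot\sigma$ and $\tfrac12 d_2\cdot\sigma$ is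
  -- $\tfrac i2(d_1\times d_2)\cdot\sigma$, and $\operatorname{tr}\sigma_a\sigma_b=2\delta_{ab}$.
  have key : (blochProj (e k) * ((blochProj d₁ - blochProj 0) * (blochProj d₂ - blochProj 0)
      - (blochProj d₂ - blochProj 0) * (blochProj d₁ - blochProj 0))).trace
      = Complex.I / 2 * ((dotProduct (e k) (crossProduct d₁ d₂) : ℝ) : ℂ) := by
    simp only [blochProj_eq, Matrix.trace_fin_two, Matrix.mul_apply, Fin.sum_univ_two, cross_apply,
      dotProduct, Fin.sum_univ_three, Matrix.sub_apply]
    simp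
    ring_nf
  rw [key]
  push_cast
  field_simp [Complex.I_ne_zero]
  ring

theorem hasDerivAt_blochVec_fst {M : ℝ} (hM : M ≠ 0) (k : ℝ × ℝ) :
    HasDerivAt (fun t : ℝ => blochVec M (t, k.2))
      ![(dispersion M k ^ 2 - k.1 ^ 2) / dispersion M k ^ 3, -(k.1 * k.2) / dispersion M k ^ 3,
        -(k.1 * M) / dispersion M k ^ 3] k.1 := by
  have hω := dispersion_pos hM k
  have hd : HasDerivAt (fun t : ℝ => dispersion M (t, k.2)) (k.1 / dispersion M k) k.1 := by
    have := ((((hasDerivAt_id k.1).pow 2).add_const (k.2 ^ 2)).add_const (M ^ 2)).sqrt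
      (by simp; positivity)
    exact this.congr_deriv (by simp [dispersion]; field_simp)
  have hk : dispersion M (k.1, k.2) ≠ 0 := hω.ne'
  rw [hasDerivAt_pi]
  intro i
  fin_cases i
  · exact ((hasDerivAt_id k.1).div hd hk).congr_deriv (by simp; field_simp)
  · exact ((hasDerivAt_const k.1 k.2).div hd hk).congr_deriv (by simp; field_simp)
  · exact ((hasDerivAt_const k.1 M).div hd hk).congr_deriv (by simp; field_simp)

theorem hasDerivAt_blochVec_snd {M : ℝ} (hM : M ≠ 0) (k : ℝ × ℝ) :
    HasDerivAt (fun t : ℝ => blochVec M (k.1, t))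
      ![-(k.1 * k.2) / dispersion M k ^ 3, (dispersion M k ^ 2 - k.2 ^ 2) / dispersion M k ^ 3,
        -(k.2 * M) / dispersion M k ^ 3] k.2 := by
  have hω := dispersion_pos hM k
  have hd : HasDerivAt (fun t : ℝ => dispersion M (k.1, t)) (k.2 / dispersion M k) k.2 := by
    have := ((((hasDerivAt_id k.2).pow 2).const_add (k.1 ^ 2)).add_const (M ^ 2)).sqrt
      (by simp; positivity)
    exact this.congr_deriv (by simp [dispersion]; field_simp)
  have hk : dispersion M (k.1, k.2) ≠ 0 := hω.ne'
  rw [hasDerivAt_pi]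
  intro i
  fin_cases i
  · exact ((hasDerivAt_const k.2 k.1).div hd hk).congr_deriv (by simp; field_simp)
  · exact ((hasDerivAt_id k.2).div hd hk).congr_deriv (by simp; field_simp)
  · exact ((hasDerivAt_const k.2 M).div hd hk).congr_deriv (by simp; field_simp)

theorem chernDensity_bandProj {M : ℝ} (hM : M ≠ 0) (k : ℝ × ℝ) :
    chernDensity (bandProj M) k
      = ((1 / (4 * Real.pi) * solidAngleDensity (blochVec M) k : ℝ) : ℂ) :=
  chernDensity_blochProj (hasDerivAt_blochVec_fst hM k) (hasDerivAt_blochVec_snd hM k)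

theorem solidAngleDensity_blochVec {M : ℝ} (hM : M ≠ 0) (k : ℝ × ℝ) :
    solidAngleDensity (blochVec M) k = M / dispersion M k ^ 3 := by
  have hω := dispersion_pos hM k
  rw [solidAngleDensity, (hasDerivAt_blochVec_fst hM k).deriv, (hasDerivAt_blochVec_snd hM k).deriv]
  simp only [blochVec, cross_apply, dotProduct, Fin.sum_univ_three, Matrix.cons_val]
  field_simp
  ring_nf

theorem integral_Ioi_div_sqrt_cube {M : ℝ} (hM : M ≠ 0) :
    ∫ r in Set.Ioi (0 : ℝ), r / √(r ^ 2 + M ^ 2) ^ 3 = 1 / |M| := by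
  have hpos : ∀ r : ℝ, 0 < √(r ^ 2 + M ^ 2) := fun r => Real.sqrt_pos.2 (by positivity)
  -- The primitive is $-(r^2+M^2)^{-1/2}$; as the integrand is nonnegative, its limit at infinity
  -- suffices.
  have h := integral_Ioi_of_hasDerivAt_of_nonneg' (a := 0) (l := 0)
    (g := fun r : ℝ => -(√(r ^ 2 + M ^ 2))⁻¹) (g' := fun r : ℝ => r / √(r ^ 2 + M ^ 2) ^ 3)
    (fun r _ => ?_) (fun r hr => div_nonneg (le_of_lt hr) (pow_nonneg (hpos r).le 3)) ?_
  · rw [h]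
    simp [Real.sqrt_sq_eq_abs]
  · have h1 := ((((hasDerivAt_id r).pow 2).add_const (M ^ 2)).sqrt (by simp; positivity))
    have h2 := (h1.inv (hpos r).ne').neg
    have := hpos r
    exact h2.congr_deriv (by simp; field_simp)
  · rw [← neg_zero]
    refine (tendsto_inv_atTop_zero.comp (tendsto_atTop_mono (fun r => ?_) tendsto_id)).neg
    exact Real.le_sqrt_of_sq_le (by simp; positivity)

theorem integral_div_dispersion_cube {M : ℝ} (hM : M ≠ 0) :
    ∫ k, M / dispersion M k ^ 3 = 2 * Real.pi * Real.sign M := by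
  rw [← integral_comp_polarCoord_symm, polarCoord_target]
  have hcongr : ∀ p : ℝ × ℝ, p.1 • (M / dispersion M (polarCoord.symm p) ^ 3)
      = p.1 / √(p.1 ^ 2 + M ^ 2) ^ 3 * M := by
    intro p
    have : dispersion M (polarCoord.symm p) = √(p.1 ^ 2 + M ^ 2) := by
      rw [dispersion, polarCoord_symm_apply]
      congr 1
      linear_combination p.1 ^ 2 * Real.cos_sq_add_sin_sq p.2
    rw [this, smul_eq_mul]
    ring
  simp only [hcongr]
  rw [Measure.volume_eq_prod,
    setIntegral_prod_mul (fun r : ℝ => r / √(r ^ 2 + M ^ 2) ^ 3) (fun _ : ℝ => M),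
    integral_Ioi_div_sqrt_cube hM]
  have hpi := Real.pi_pos
  rcases hM.lt_or_gt with h | h
  · simp [Real.sign_of_neg h, abs_of_neg h]
    field_simp
    ring_nf
    rw [max_eq_left (by positivity)]
  · simp [Real.sign_of_pos h, abs_of_pos h]
    field_simp
    ring_nf
    rw [max_eq_left (by positivity)]

theorem integral_solidAngleDensity_blochVec {M : ℝ} (hM : M ≠ 0) :
    ∫ k, solidAngleDensity (blochVec M) k = 2 * Real.pi * Real.sign M := by
  simp only [solidAngleDensity_blochVec hM, integral_div_dispersion_cube hM]

theorem formalChern_bandProj_eq_integral {M : ℝ} (hM : M ≠ 0) :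
    formalChern (bandProj M)
      = ((1 / (4 * Real.pi) * ∫ k, solidAngleDensity (blochVec M) k : ℝ) : ℂ) := by
  simp only [formalChern, chernDensity_bandProj hM]
  rw [integral_complex_ofReal, integral_const_mul]

theorem formalChern_bandProj {M : ℝ} (hM : M ≠ 0) :
    formalChern (bandProj M) = ((1 / 2 * Real.sign M : ℝ) : ℂ) := by
  rw [formalChern_bandProj_eq_integral hM, integral_solidAngleDensity_blochVec hM]
  have := Real.pi_ne_zero
  congr 1
  field_simp
  ring

/-- The Bochner integral of a non-integrable function is 0 by convention, whereas the value found
here is $\pm\tfrac12$. -/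
theorem integrable_chernDensity_bandProj {M : ℝ} (hM : M ≠ 0) :
    Integrable (chernDensity (bandProj M)) := by
  by_contra h
  have h0 : formalChern (bandProj M) = 0 := integral_undef h
  rw [formalChern_bandProj hM] at h0
  have h1 : 1 / 2 * Real.sign M = 0 := by exact_mod_cast h0
  have h2 : Real.sign M ≠ 0 := by rwa [Ne, Real.sign_eq_zero_iff]
  simp [h2] at h1

/-- The reflection preserves the measure but flips the sign of $\partial_2$, hence of the
commutator. -/
theorem formalChern_comp_neg_snd (Q : ℝ × ℝ → Mat2) :
    formalChern (fun k => Q (k.1, -k.2)) = -formalChern Q := by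
  have h : ∀ k, chernDensity (fun k => Q (k.1, -k.2)) k = -chernDensity Q (k.1, -k.2) := by
    intro k
    have h2 : matD2 (fun k => Q (k.1, -k.2)) k = -matD2 Q (k.1, -k.2) := by
      ext i j
      simpa [matD2] using deriv_comp_neg (fun t : ℝ => Q (k.1, t) i j) k.2
    have h1 : matD1 (fun k => Q (k.1, -k.2)) k = matD1 Q (k.1, -k.2) := rfl
    rw [chernDensity, chernDensity, h1, h2, ← mul_neg, ← Matrix.trace_neg, ← Matrix.mul_neg]
    congr 4
    simp [sub_eq_add_neg, add_comm]
  have hflip : MeasurePreserving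
      ((MeasurableEquiv.refl ℝ).prodCongr (MeasurableEquiv.neg ℝ)) volume volume :=
    (MeasurePreserving.id volume).prod (Measure.measurePreserving_neg volume)
  rw [formalChern, formalChern]
  simp only [h, integral_neg]
  congr 1
  exact hflip.integral_comp' (chernDensity Q)

end Curvature

/-! ### The glued disks as a sphere -/

section BrillouinZone

/-- The square of the distance of a point of the closed disk from the center. -/
def diskRadiusSq (p : ClosedDisk) : ℝ := p.1.1 ^ 2 + p.1.2 ^ 2

theorem diskRadiusSq_le_one (p : ClosedDisk) : diskRadiusSq p ≤ 1 := p.2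

theorem diskRadiusSq_nonneg (p : ClosedDisk) : 0 ≤ diskRadiusSq p := by
  unfold diskRadiusSq
  positivity

theorem continuous_diskRadiusSq : Continuous diskRadiusSq := by
  unfold diskRadiusSq
  fun_prop

instance : CompactSpace ClosedDisk := by
  refine isCompact_iff_compactSpace.1 ?_
  have hcl : IsClosed {p : ℝ × ℝ | p.1 ^ 2 + p.2 ^ 2 ≤ 1} :=
    isClosed_le (by fun_prop) (by fun_prop)
  refine (isCompact_Icc (a := ((-1, -1) : ℝ × ℝ)) (b := (1, 1))).of_isClosed_subset hcl
    fun p hp => ?_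
  have hp' : p.1 ^ 2 + p.2 ^ 2 ≤ 1 := hp
  have h1 := abs_le.1 (abs_le_one_iff_mul_self_le_one.2 (by nlinarith [sq_nonneg p.2]) : |p.1| ≤ 1)
  have h2 := abs_le.1 (abs_le_one_iff_mul_self_le_one.2 (by nlinarith [sq_nonneg p.1]) : |p.2| ≤ 1)
  exact ⟨⟨h1.1, h2.1⟩, ⟨h1.2, h2.2⟩⟩

instance : CompactSpace CompactBZ :=
  inferInstanceAs (CompactSpace (Quot GlueRel))

theorem continuous_inclPlus : Continuous inclPlus := continuous_quot_mk.comp continuous_inl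

theorem continuous_inclMinus : Continuous inclMinus := continuous_quot_mk.comp continuous_inr

theorem inclPlus_eq_inclMinus {p : ClosedDisk} (hp : diskRadiusSq p = 1) :
    inclPlus p = inclMinus p :=
  Quot.sound (GlueRel.boundary p hp)

@[elab_as_elim]
theorem CompactBZ.ind {motive : CompactBZ → Prop} (plus : ∀ p, motive (inclPlus p))
    (minus : ∀ p, motive (inclMinus p)) (q : CompactBZ) : motive q :=
  Quot.ind (Sum.rec plus minus) q

/-- The function on the sphere that is `f` on the first disk and `g` on the second one. -/
def CompactBZ.glue {X : Type*} (f g : ClosedDisk → X)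
    (h : ∀ p, diskRadiusSq p = 1 → f p = g p) : CompactBZ → X :=
  Quot.lift (Sum.elim f g) fun _ _ hr => by
    obtain ⟨p, hp⟩ := hr
    exact h p hp

theorem CompactBZ.continuous_glue {X : Type*} [TopologicalSpace X] {f g : ClosedDisk → X}
    (h : ∀ p, diskRadiusSq p = 1 → f p = g p) (hf : Continuous f) (hg : Continuous g) :
    Continuous (CompactBZ.glue f g h) :=
  continuous_quot_lift _ (hf.sumElim hg)

/-- The parametrization of the upper (`c = 1`) or lower (`c = -1`) hemisphere by the disk. -/
noncomputable def hemisphere (c : ℝ) (hc : c ^ 2 = 1) (p : ClosedDisk) :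
    Metric.sphere (0 : EuclideanSpace ℝ (Fin 3)) 1 :=
  ⟨!₂[p.1.1, p.1.2, c * √(1 - diskRadiusSq p)], by
    have h := Real.sq_sqrt (sub_nonneg.2 (diskRadiusSq_le_one p))
    rw [mem_sphere_zero_iff_norm, EuclideanSpace.norm_eq, Real.sqrt_eq_one]
    simp only [Fin.sum_univ_three, Real.norm_eq_abs, sq_abs]
    simp only [Matrix.cons_val, mul_pow, hc, h]
    simp only [diskRadiusSq]
    ring⟩

theorem continuous_hemisphere (c : ℝ) (hc : c ^ 2 = 1) : Continuous (hemisphere c hc) := by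
  refine Continuous.subtype_mk ((PiLp.continuous_toLp 2 _).comp (continuous_pi fun i => ?_)) _
  have := continuous_diskRadiusSq
  fin_cases i <;> simp <;> fun_prop

theorem hemisphere_eq_iff {c d : ℝ} (hc : c ^ 2 = 1) (hd : d ^ 2 = 1) {p q : ClosedDisk} :
    hemisphere c hc p = hemisphere d hd q ↔
      p = q ∧ c * √(1 - diskRadiusSq p) = d * √(1 - diskRadiusSq q) := by
  constructor
  · intro h
    have h' := congrArg (fun v : Metric.sphere (0 : EuclideanSpace ℝ (Fin 3)) 1 => v.1) h
    have h0 := congrArg (fun v : EuclideanSpace ℝ (Fin 3) => v 0) h'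
    have h1 := congrArg (fun v : EuclideanSpace ℝ (Fin 3) => v 1) h'
    have h2 := congrArg (fun v : EuclideanSpace ℝ (Fin 3) => v 2) h'
    exact ⟨Subtype.ext (Prod.ext h0 h1), h2⟩
  · rintro ⟨rfl, h⟩
    simp only [hemisphere, h]

/-- The map of the glued disks onto the unit sphere. -/
noncomputable def CompactBZ.toSphere :
    CompactBZ → Metric.sphere (0 : EuclideanSpace ℝ (Fin 3)) 1 :=
  CompactBZ.glue (hemisphere 1 (one_pow 2)) (hemisphere (-1) neg_one_sq) fun p hp =>
    (hemisphere_eq_iff _ _).2 ⟨rfl, by simp [hp]⟩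

theorem CompactBZ.continuous_toSphere : Continuous CompactBZ.toSphere :=
  CompactBZ.continuous_glue _ (continuous_hemisphere _ _) (continuous_hemisphere _ _)

theorem diskRadiusSq_eq_one_of_sqrt_eq_neg {p : ClosedDisk}
    (h : 1 * √(1 - diskRadiusSq p) = -1 * √(1 - diskRadiusSq p)) : diskRadiusSq p = 1 := by
  have h0 : √(1 - diskRadiusSq p) = 0 := by linarith
  rw [Real.sqrt_eq_zero (sub_nonneg.2 (diskRadiusSq_le_one p))] at h0
  linarith

/-- Both hemispheres project vertically to the disk, so they meet only where $\sqrt{1-|p|^2}=0$,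
which is the glued circle. -/
theorem CompactBZ.injective_toSphere : Function.Injective CompactBZ.toSphere := by
  intro a b
  induction a using CompactBZ.ind with
  | plus p =>
    induction b using CompactBZ.ind with
    | plus q => exact fun h => congrArg inclPlus ((hemisphere_eq_iff (one_pow 2) (one_pow 2)).1 h).1
    | minus q =>
      intro h
      obtain ⟨rfl, h⟩ := (hemisphere_eq_iff (one_pow 2) neg_one_sq).1 h
      exact inclPlus_eq_inclMinus (diskRadiusSq_eq_one_of_sqrt_eq_neg h)
  | minus p =>
    induction b using CompactBZ.ind with
    | plus q =>
      intro h
      obtain ⟨rfl, h⟩ := (hemisphere_eq_iff neg_one_sq (one_pow 2)).1 h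
      exact (inclPlus_eq_inclMinus (diskRadiusSq_eq_one_of_sqrt_eq_neg h.symm)).symm
    | minus q => exact fun h => congrArg inclMinus ((hemisphere_eq_iff neg_one_sq neg_one_sq).1 h).1

theorem exists_hemisphere_eq (v : Metric.sphere (0 : EuclideanSpace ℝ (Fin 3)) 1) {c : ℝ}
    (hc : c ^ 2 = 1) (hv : 0 ≤ c * v.1 2) : ∃ p, hemisphere c hc p = v := by
  have hn : v.1 0 ^ 2 + v.1 1 ^ 2 + v.1 2 ^ 2 = 1 := by
    have h := mem_sphere_zero_iff_norm.1 v.2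
    rw [EuclideanSpace.norm_eq, Real.sqrt_eq_one] at h
    simpa only [Fin.sum_univ_three, Real.norm_eq_abs, sq_abs] using h
  refine ⟨⟨(v.1 0, v.1 1), by nlinarith [sq_nonneg (v.1 2)]⟩, ?_⟩
  have h2 : c * √(1 - (v.1 0 ^ 2 + v.1 1 ^ 2)) = v.1 2 := by
    have : 1 - (v.1 0 ^ 2 + v.1 1 ^ 2) = (c * v.1 2) ^ 2 := by rw [mul_pow, hc]; linarith
    rw [this, Real.sqrt_sq hv, ← mul_assoc, ← pow_two, hc, one_mul]
  refine Subtype.ext (PiLp.ext fun i => ?_)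
  fin_cases i
  · rfl
  · rfl
  · exact h2

theorem CompactBZ.surjective_toSphere : Function.Surjective CompactBZ.toSphere := by
  intro v
  rcases le_total 0 (v.1 2) with h | h
  · obtain ⟨p, hp⟩ := exists_hemisphere_eq v (c := 1) (by norm_num) (by simpa using h)
    exact ⟨inclPlus p, hp⟩
  · obtain ⟨p, hp⟩ := exists_hemisphere_eq v (c := -1) (by norm_num) (by simpa using h)
    exact ⟨inclMinus p, hp⟩

/-- A continuous bijection from a compact space to a Hausdorff space is a homeomorphism. -/
theorem nonempty_homeomorph_sphere :
    Nonempty (CompactBZ ≃ₜ Metric.sphere (0 : EuclideanSpace ℝ (Fin 3)) 1) :=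
  ⟨Continuous.homeoOfEquivCompactToT2
    (f := Equiv.ofBijective _ ⟨CompactBZ.injective_toSphere, CompactBZ.surjective_toSphere⟩)
    CompactBZ.continuous_toSphere⟩

theorem tendsto_toDisk {p : ClosedDisk} (hp : diskRadiusSq p = 1) :
    Tendsto (fun r : ℝ => toDisk (r * p.1.1, r * p.1.2)) atTop (𝓝 p) := by
  have h1 : Tendsto (fun r : ℝ => r / √(1 + r ^ 2)) atTop (𝓝 1) := by
    have h2 : Tendsto (fun r : ℝ => (√((r ^ 2)⁻¹ + 1))⁻¹) atTop (𝓝 (√(0 + 1))⁻¹) :=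
      ((((tendsto_pow_atTop two_ne_zero).inv_tendsto_atTop).add_const 1).sqrt).inv₀ (by simp)
    simp only [zero_add, Real.sqrt_one, inv_one] at h2
    refine h2.congr' ?_
    filter_upwards [eventually_gt_atTop 0] with r hr
    have : 1 + r ^ 2 = r ^ 2 * ((r ^ 2)⁻¹ + 1) := by field_simp
    rw [this, Real.sqrt_mul (by positivity), Real.sqrt_sq hr.le]
    field_simp
  have hval : ∀ r : ℝ, (toDisk (r * p.1.1, r * p.1.2)).1
      = (r / √(1 + r ^ 2) * p.1.1, r / √(1 + r ^ 2) * p.1.2) := by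
    intro r
    have : 1 + (r * p.1.1) ^ 2 + (r * p.1.2) ^ 2 = 1 + r ^ 2 := by
      rw [diskRadiusSq] at hp
      linear_combination r ^ 2 * hp
    simp only [toDisk, this]
    ring_nf
  rw [tendsto_subtype_rng]
  simp only [hval]
  have := (h1.mul_const p.1.1).prodMk_nhds (h1.mul_const p.1.2)
  simpa using this

/-- Interior points are attained, with preimage $p/\sqrt{1-|p|^2}$; boundary points are limits along
rays. -/
theorem denseRange_toDisk : DenseRange toDisk := by
  intro p
  rcases (diskRadiusSq_le_one p).lt_or_eq with h | h
  · refine subset_closure ⟨(p.1.1 / √(1 - diskRadiusSq p), p.1.2 / √(1 - diskRadiusSq p)), ?_⟩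
    have hs : 0 < 1 - diskRadiusSq p := sub_pos.2 h
    have h1 : 1 + (p.1.1 / √(1 - diskRadiusSq p)) ^ 2 + (p.1.2 / √(1 - diskRadiusSq p)) ^ 2
        = (1 - diskRadiusSq p)⁻¹ := by
      simp only [div_pow, Real.sq_sqrt hs.le]
      field_simp
      rw [diskRadiusSq]
      ring
    have h2 := Real.sqrt_pos.2 hs
    refine Subtype.ext (Prod.ext ?_ ?_) <;>
    · simp only [toDisk, h1, Real.sqrt_inv]
      field_simp
  · exact mem_closure_of_tendsto (tendsto_toDisk h) (.of_forall fun r => ⟨_, rfl⟩)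

theorem continuousMap_compactBZ_ext {X : Type*} [TopologicalSpace X] [T2Space X]
    {f g : C(CompactBZ, X)} (hp : ∀ k, f (inclPlus (toDisk k)) = g (inclPlus (toDisk k)))
    (hm : ∀ k, f (inclMinus (toDisk k)) = g (inclMinus (toDisk k))) : f = g := by
  have h1 : f ∘ inclPlus = g ∘ inclPlus := denseRange_toDisk.equalizer
    (f.continuous.comp continuous_inclPlus) (g.continuous.comp continuous_inclPlus) (funext hp)
  have h2 : f ∘ inclMinus = g ∘ inclMinus := denseRange_toDisk.equalizer
    (f.continuous.comp continuous_inclMinus) (g.continuous.comp continuous_inclMinus) (funext hm)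
  ext q
  induction q using CompactBZ.ind with
  | plus p => exact congrFun h1 p
  | minus p => exact congrFun h2 p

/-! ### Extension of the projections to infinity and gluing -/

theorem diskRadiusSq_diskBoundary (θ : ℝ) : diskRadiusSq (diskBoundary θ) = 1 :=
  Real.cos_sq_add_sin_sq θ

/-- The continuous extension of `blochVec M` to the closed disk. -/
noncomputable def diskVec (M : ℝ) (p : ClosedDisk) : Fin 3 → ℝ :=
  (√(diskRadiusSq p + M ^ 2 * (1 - diskRadiusSq p)))⁻¹ •
    ![p.1.1, p.1.2, M * √(1 - diskRadiusSq p)]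

theorem diskVec_denom_pos {M : ℝ} (hM : M ≠ 0) (p : ClosedDisk) :
    0 < diskRadiusSq p + M ^ 2 * (1 - diskRadiusSq p) := by
  rcases (diskRadiusSq_le_one p).lt_or_eq with h | h
  · have := sub_pos.2 h
    have := diskRadiusSq_nonneg p
    positivity
  · simp [h]

theorem continuous_diskVec {M : ℝ} (hM : M ≠ 0) : Continuous (diskVec M) := by
  have hr := continuous_diskRadiusSq
  unfold diskVec
  refine Continuous.smul (Continuous.inv₀ (by fun_prop) fun p =>
    (Real.sqrt_pos.2 (diskVec_denom_pos hM p)).ne') (continuous_pi fun i => ?_)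
  fin_cases i <;> simp <;> fun_prop

theorem diskVec_sq {M : ℝ} (hM : M ≠ 0) (p : ClosedDisk) :
    diskVec M p 0 ^ 2 + diskVec M p 1 ^ 2 + diskVec M p 2 ^ 2 = 1 := by
  have h := diskVec_denom_pos hM p
  have h1 := Real.sq_sqrt (sub_nonneg.2 (diskRadiusSq_le_one p))
  simp only [diskVec, Pi.smul_apply, Matrix.cons_val, smul_eq_mul, mul_pow, inv_pow, h1,
    Real.sq_sqrt h.le]
  field_simp
  simp only [diskRadiusSq]

/-- The mass drops out on the circle; this is what permits gluing different masses. -/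
theorem diskVec_of_boundary (M : ℝ) {p : ClosedDisk} (hp : diskRadiusSq p = 1) :
    diskVec M p = ![p.1.1, p.1.2, 0] := by
  simp [diskVec, hp]

theorem diskVec_toDisk (M : ℝ) (k : ℝ × ℝ) : diskVec M (toDisk k) = blochVec M k := by
  have hs : 0 < 1 + k.1 ^ 2 + k.2 ^ 2 := by positivity
  have h2 := Real.sqrt_pos.2 hs
  have h1 : diskRadiusSq (toDisk k) = (k.1 ^ 2 + k.2 ^ 2) / (1 + k.1 ^ 2 + k.2 ^ 2) := by
    simp only [diskRadiusSq, toDisk, div_pow, Real.sq_sqrt hs.le]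
    ring
  have h3 : 1 - diskRadiusSq (toDisk k) = (1 + k.1 ^ 2 + k.2 ^ 2)⁻¹ := by
    rw [h1]
    field_simp
    ring
  have h4 : diskRadiusSq (toDisk k) + M ^ 2 * (1 - diskRadiusSq (toDisk k))
      = (k.1 ^ 2 + k.2 ^ 2 + M ^ 2) / (1 + k.1 ^ 2 + k.2 ^ 2) := by
    rw [h3, h1]
    field_simp
  rw [diskVec, h4, h3, Real.sqrt_div (by positivity), Real.sqrt_inv]
  ext i
  fin_cases i <;> simp [blochVec, dispersion, toDisk] <;> field_simp

/-- The continuous extension of `bandProj M` to the closed disk. -/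
noncomputable def diskProj (M : ℝ) (p : ClosedDisk) : Mat2 := blochProj (diskVec M p)

theorem continuous_blochProj : Continuous blochProj := by
  unfold blochProj
  fun_prop

theorem continuous_diskProj {M : ℝ} (hM : M ≠ 0) : Continuous (diskProj M) :=
  continuous_blochProj.comp (continuous_diskVec hM)

theorem diskProj_toDisk (M : ℝ) (k : ℝ × ℝ) : diskProj M (toDisk k) = bandProj M k := by
  rw [diskProj, diskVec_toDisk, bandProj_eq]

theorem isLineProj_diskProj {M : ℝ} (hM : M ≠ 0) (p : ClosedDisk) : IsLineProj (diskProj M p) :=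
  isLineProj_blochProj (diskVec_sq hM p)

theorem tendsto_bandProj_radial {M : ℝ} (hM : M ≠ 0) (θ : ℝ) :
    Tendsto (fun r : ℝ => bandProj M (r * Real.cos θ, r * Real.sin θ)) atTop
      (𝓝 (blochProj ![Real.cos θ, Real.sin θ, 0])) := by
  have h := ((continuous_diskProj hM).tendsto (diskBoundary θ)).comp
    (tendsto_toDisk (diskRadiusSq_diskBoundary θ))
  rw [diskProj, diskVec_of_boundary M (diskRadiusSq_diskBoundary θ)] at h
  refine h.congr fun r => ?_
  rw [Function.comp_apply, diskProj_toDisk]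
  rfl

/-- The glued projection on the compactified Brillouin zone. -/
noncomputable def gluedProj {mp mm : ℝ} (hp : mp ≠ 0) (hm : mm ≠ 0) : C(CompactBZ, Mat2) where
  toFun := CompactBZ.glue (diskProj mp) (diskProj mm) fun p h => by
    rw [diskProj, diskProj, diskVec_of_boundary _ h, diskVec_of_boundary _ h]
  continuous_toFun := CompactBZ.continuous_glue _ (continuous_diskProj hp) (continuous_diskProj hm)

variable {mp mm : ℝ} (hp : mp ≠ 0) (hm : mm ≠ 0)

theorem gluedProj_inclPlus (p : ClosedDisk) :
    gluedProj hp hm (inclPlus p) = diskProj mp p := rfl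

theorem gluedProj_inclMinus (p : ClosedDisk) :
    gluedProj hp hm (inclMinus p) = diskProj mm p := rfl

theorem isLineProj_gluedProj (q : CompactBZ) : IsLineProj (gluedProj hp hm q) := by
  induction q using CompactBZ.ind with
  | plus p => exact isLineProj_diskProj hp p
  | minus p => exact isLineProj_diskProj hm p

theorem chernIntegral_gluedProj :
    chernIntegral (gluedProj hp hm) = formalChern (bandProj mp) - formalChern (bandProj mm) := by
  simp only [chernIntegral, gluedProj_inclPlus, gluedProj_inclMinus, diskProj_toDisk]
  rw [formalChern_comp_neg_snd (bandProj mm), ← sub_eq_add_neg]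

end BrillouinZone

/-! ### The band line bundle -/

section LineBundle

namespace BandFiber

variable {B : Type*} {P : B → Mat2} {q : B}

@[ext]
theorem ext {v w : BandFiber P q} (h : v.vec = w.vec) : v = w := Subtype.ext h

@[simp]
theorem vec_smul (c : ℂ) (v : BandFiber P q) : (c • v).vec = c • v.vec := rfl

/-- The `i`-th column of `P(q)` as an element of the fiber. -/
def column (P : B → Mat2) (q : B) (i : Fin 2) : BandFiber P q :=
  ⟨(P q).mulVec (Pi.single i 1), ⟨Pi.single i 1, rfl⟩⟩

@[simp]
theorem vec_column (i j : Fin 2) : (column P q i).vec j = P q j i := by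
  simp [column, vec]

theorem column_ne_zero {i : Fin 2} (h : P q i i ≠ 0) : column P q i ≠ 0 := fun h0 => by
  apply h
  have h1 := vec_column (P := P) (q := q) i i
  rw [h0] at h1
  exact h1.symm

/-- A nonzero column spans the one-dimensional fiber, and the coefficient is read off from
coordinate $i$. -/
theorem eq_smul_column (hP : IsLineProj (P q)) {i : Fin 2} (h : P q i i ≠ 0)
    (v : BandFiber P q) : v = (v.vec i / P q i i) • column P q i := by
  have h1 : Module.finrank ℂ (BandFiber P q) = 1 := hP.2.2
  obtain ⟨c, rfl⟩ := (finrank_eq_one_iff_of_nonzero' _ (column_ne_zero h)).1 h1 v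
  rw [vec_smul, Pi.smul_apply, vec_column, smul_eq_mul, mul_div_cancel_right₀ _ h]

theorem vec_apply_mul (hP : IsLineProj (P q)) {i : Fin 2} (h : P q i i ≠ 0)
    (v : BandFiber P q) (j : Fin 2) : v.vec j = v.vec i / P q i i * P q j i := by
  conv_lhs => rw [eq_smul_column hP h v]
  rw [vec_smul, Pi.smul_apply, vec_column, smul_eq_mul]

theorem vec_apply_ne_zero (hP : IsLineProj (P q)) {i : Fin 2} (h : P q i i ≠ 0)
    {v : BandFiber P q} (hv : v ≠ 0) : v.vec i ≠ 0 := fun h0 => by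
  apply hv
  rw [eq_smul_column hP h v, h0, zero_div, zero_smul]

variable [TopologicalSpace B]

theorem isInducing_proj_vec (P : B → Mat2) :
    IsInducing fun v : TotalSpace ℂ (BandFiber P) => (v.proj, v.snd.vec) := ⟨rfl⟩

theorem continuous_vec (P : B → Mat2) :
    Continuous fun v : TotalSpace ℂ (BandFiber P) => v.snd.vec :=
  (isInducing_proj_vec P).continuous.snd

theorem continuous_proj (P : B → Mat2) :
    Continuous fun v : TotalSpace ℂ (BandFiber P) => v.proj :=
  (isInducing_proj_vec P).continuous.fst

theorem isInducing_mk (P : B → Mat2) (q : B) :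
    IsInducing (TotalSpace.mk q : BandFiber P q → TotalSpace ℂ (BandFiber P)) := by
  rw [← (isInducing_proj_vec P).of_comp_iff]
  exact isInducing_const_prod.2 ⟨rfl⟩

end BandFiber

/-- From $A=AA^*$ one gets $A_{ii}=\sum_j|A_{ij}|^2$, so a zero diagonal would force $A=0$. Hence
the two coordinate charts cover the base. -/
theorem IsLineProj.exists_apply_ne_zero {A : Mat2} (hA : IsLineProj A) : ∃ i, A i i ≠ 0 := by
  by_contra! h
  have key : ∀ i j, A i j = 0 := by
    intro i j
    have h1 : A * A.conjTranspose = A := by rw [hA.1.eq, hA.2.1]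
    have h2 : ∑ j, (Complex.normSq (A i j) : ℂ) = 0 := by
      rw [← h i]
      conv_rhs => rw [← h1, Matrix.mul_apply]
      simp only [Matrix.conjTranspose_apply, Complex.star_def, Complex.mul_conj]
    have h3 : ∑ j, Complex.normSq (A i j) = 0 := by exact_mod_cast h2
    exact Complex.normSq_eq_zero.1
      ((Finset.sum_eq_zero_iff_of_nonneg fun _ _ => Complex.normSq_nonneg _).1 h3 j
        (Finset.mem_univ j))
  have h0 : A = 0 := Matrix.ext key
  have := hA.2.2
  rw [h0, map_zero, LinearMap.range_zero, finrank_bot] at this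
  exact zero_ne_one this

section Trivialization

variable {B : Type*} [TopologicalSpace B] {P : B → Mat2} (hc : Continuous P)
  (hP : ∀ q, IsLineProj (P q))

/-- The trivialization of the band bundle by the `i`-th coordinate. -/
noncomputable def bandTrivialization (i : Fin 2) :
    Trivialization ℂ (TotalSpace.proj : TotalSpace ℂ (BandFiber P) → B) where
  toFun v := (v.proj, v.snd.vec i)
  invFun x := ⟨x.1, (x.2 / P x.1 i i) • BandFiber.column P x.1 i⟩
  source := TotalSpace.proj ⁻¹' {q | P q i i ≠ 0}
  target := {q | P q i i ≠ 0} ×ˢ Set.univ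
  map_source' v hv := ⟨hv, Set.mem_univ _⟩
  map_target' x hx := hx.1
  left_inv' := by
    rintro ⟨q, v⟩ hv
    exact congrArg (TotalSpace.mk q) (BandFiber.eq_smul_column (hP q) hv v).symm
  right_inv' := by
    rintro ⟨q, z⟩ ⟨hq, -⟩
    have hq' : P q i i ≠ 0 := hq
    simp [div_mul_cancel₀ _ hq']
  open_source := (isOpen_ne_fun (hc.matrix_elem i i) continuous_const).preimage
    (BandFiber.continuous_proj P)
  open_target := (isOpen_ne_fun (hc.matrix_elem i i) continuous_const).prod isOpen_univ
  continuousOn_toFun := ((BandFiber.continuous_proj P).prodMk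
    ((continuous_apply i).comp (BandFiber.continuous_vec P))).continuousOn
  continuousOn_invFun := by
    rw [(BandFiber.isInducing_proj_vec P).continuousOn_iff]
    refine continuousOn_fst.prodMk (continuousOn_pi.2 fun j => ?_)
    have h : ∀ j, Continuous fun x : B × ℂ => P x.1 j i :=
      fun j => (hc.matrix_elem j i).comp continuous_fst
    refine ((continuousOn_snd.div (h i).continuousOn fun x hx => hx.1).mul
      (h j).continuousOn).congr fun x hx => ?_
    simp
  baseSet := {q | P q i i ≠ 0}
  open_baseSet := isOpen_ne_fun (hc.matrix_elem i i) continuous_const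
  source_eq := rfl
  target_eq := rfl
  proj_toFun _ _ := rfl

instance bandTrivialization_isLinear (i : Fin 2) : (bandTrivialization hc hP i).IsLinear ℂ where
  linear _ _ := { map_add := fun _ _ => rfl, map_smul := fun _ _ => rfl }

/-- The band bundle is a fiber bundle. -/
noncomputable abbrev bandFiberBundle : FiberBundle ℂ (BandFiber P) where
  totalSpaceMk_isInducing' := BandFiber.isInducing_mk P
  trivializationAtlas' := Set.range (bandTrivialization hc hP)
  trivializationAt' q := bandTrivialization hc hP (hP q).exists_apply_ne_zero.choose
  mem_baseSet_trivializationAt' q := (hP q).exists_apply_ne_zero.choose_spec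
  trivialization_mem_atlas' _ := ⟨_, rfl⟩

theorem exists_vectorBundle_band (hc : Continuous P) (hP : ∀ q, IsLineProj (P q)) :
    ∃ _ : FiberBundle ℂ (BandFiber P), VectorBundle ℂ ℂ (BandFiber P) := by
  refine ⟨bandFiberBundle hc hP, ?_⟩
  let _ := bandFiberBundle hc hP
  refine ⟨?_, ?_⟩
  · rintro e ⟨i, rfl⟩
    exact bandTrivialization_isLinear hc hP i
  · rintro e e' ⟨i, rfl⟩ ⟨j, rfl⟩
    -- The vector with $i$-th coordinate 1 is column $i$ divided by $P_{ii}$; its $j$-th coordinate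
    -- $P_{ji}/P_{ii}$ is the transition function.
    have hcont : ContinuousOn (fun q => (P q i i)⁻¹ * P q j i) {q | P q i i ≠ 0} :=
      ((hc.matrix_elem i i).continuousOn.inv₀ fun q hq => hq).mul (hc.matrix_elem j i).continuousOn
    refine (((ContinuousLinearMap.toSpanSingletonCLE (𝕜 := ℂ) (E := ℂ)).continuous.comp_continuousOn
      (hcont.mono Set.inter_subset_left))).congr fun q hq => ?_
    ext
    have := Trivialization.coordChangeL_apply (R := ℂ)
      (bandTrivialization hc hP i) (bandTrivialization hc hP j) hq 1
    have h2 : (bandTrivialization hc hP i).symm q 1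
        = (1 / P q i i) • BandFiber.column P q i := by
      rw [Trivialization.symm_apply _ hq.1]
      rfl
    rw [h2] at this
    refine this.trans ?_
    have h3 : ((1 / P q i i) • BandFiber.column P q i).vec j = 1 * ((P q i i)⁻¹ * P q j i) := by
      simp
    exact h3

end Trivialization

/-! ### Winding numbers and the Chern number -/

/-- The radial retraction of the plane onto the closed disk. -/
noncomputable def diskRetraction (x : ℝ × ℝ) : ClosedDisk :=
  ⟨(x.1 / max 1 √(x.1 ^ 2 + x.2 ^ 2), x.2 / max 1 √(x.1 ^ 2 + x.2 ^ 2)), by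
    have h : 0 < max 1 √(x.1 ^ 2 + x.2 ^ 2) := lt_max_of_lt_left one_pos
    have h2 : √(x.1 ^ 2 + x.2 ^ 2) ^ 2 ≤ max 1 √(x.1 ^ 2 + x.2 ^ 2) ^ 2 := by
      gcongr
      exact le_max_right _ _
    rw [Real.sq_sqrt (by positivity)] at h2
    simp only [div_pow]
    rw [← add_div, div_le_one (by positivity)]
    exact h2⟩

theorem continuous_diskRetraction : Continuous diskRetraction := by
  have h : Continuous fun x : ℝ × ℝ => max 1 √(x.1 ^ 2 + x.2 ^ 2) := by fun_prop
  have h0 : ∀ x : ℝ × ℝ, max 1 √(x.1 ^ 2 + x.2 ^ 2) ≠ 0 := fun x =>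
    (lt_max_of_lt_left one_pos).ne'
  exact ((continuous_fst.div h h0).prodMk (continuous_snd.div h h0)).subtype_mk _

theorem diskRetraction_cos_sin (θ : ℝ) :
    diskRetraction (Real.cos θ, Real.sin θ) = diskBoundary θ := by
  apply Subtype.ext
  simp [diskRetraction, diskBoundary]

/-- A nowhere vanishing function on the closed disk has a continuous logarithm on the boundary
circle. -/
theorem exists_periodic_log {f : ClosedDisk → ℂ} (hf : Continuous f) (h0 : ∀ p, f p ≠ 0) :
    ∃ φ : ℝ → ℂ, Continuous φ ∧ (∀ θ, Complex.exp (φ θ) = f (diskBoundary θ)) ∧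
      φ (2 * Real.pi) = φ 0 := by
  -- The retraction extends $f$ to the simply connected plane, where it lifts through `exp`. The
  -- logarithm on the circle is then a function of $(\cos\theta,\sin\theta)$, hence periodic.
  obtain ⟨F, ⟨-, hF⟩, -⟩ := Complex.isCoveringMapOn_exp.existsUnique_continuousMap_lifts
    ⟨f ∘ diskRetraction, hf.comp continuous_diskRetraction⟩ (a₀ := (0, 0))
    (e₀ := Complex.log (f (diskRetraction (0, 0)))) (Complex.exp_log (h0 _)) (fun a => h0 _)
  refine ⟨fun θ => F (Real.cos θ, Real.sin θ), by fun_prop, fun θ => ?_, by simp⟩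
  rw [← diskRetraction_cos_sin]
  exact congrFun hF _

/-- Uniqueness of lifts: $\psi$ and the constant $\psi(a)$ both lift the constant 1 and agree at
$a$. -/
theorem eq_of_continuous_exp_eq_one {ψ : ℝ → ℂ} (hψ : Continuous ψ)
    (h : ∀ θ, Complex.exp (ψ θ) = 1) (a b : ℝ) : ψ a = ψ b := by
  have h1 := Complex.isCoveringMapOn_exp.existsUnique_continuousMap_lifts
    (⟨fun _ => 1, continuous_const⟩ : C(ℝ, ℂ)) (a₀ := a) (e₀ := ψ a) (h a) (fun _ => one_ne_zero)
  have h2 := h1.unique (y₁ := ⟨ψ, hψ⟩) (y₂ := ⟨fun _ => ψ a, continuous_const⟩)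
    ⟨rfl, funext h⟩ ⟨rfl, funext fun _ => h a⟩
  exact (DFunLike.congr_fun h2 b).symm

/-- Fiberwise linearity carries the sections over with the same transition function. -/
theorem IsChernNumber.of_lineBundleIso {E L : CompactBZ → Type*}
    [∀ q, AddCommGroup (E q)] [∀ q, Module ℂ (E q)] [∀ q, AddCommGroup (L q)]
    [∀ q, Module ℂ (L q)] [TopologicalSpace (TotalSpace ℂ E)] [TopologicalSpace (TotalSpace ℂ L)]
    (f : ∀ q, E q ≃ₗ[ℂ] L q)
    (hf : Continuous fun v : TotalSpace ℂ E => TotalSpace.mk' ℂ v.proj (f v.proj v.snd)) {n : ℤ}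
    (h : IsChernNumber E n) : IsChernNumber L n := by
  obtain ⟨sp, sm, hsp, hsm, hsp0, hsm0, φ, hφ, hs, hn⟩ := h
  refine ⟨fun q => f q (sp q), fun q => f q (sm q), hf.comp_continuousOn hsp,
    hf.comp_continuousOn hsm, fun q hq => (f q).map_ne_zero_iff.2 (hsp0 q hq),
    fun q hq => (f q).map_ne_zero_iff.2 (hsm0 q hq), φ, hφ, fun θ => ?_, hn⟩
  simp only [hs, map_smul]

theorem LineBundleIso.isChernNumber_iff {E L : CompactBZ → Type*}
    [∀ q, AddCommGroup (E q)] [∀ q, Module ℂ (E q)] [∀ q, AddCommGroup (L q)]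
    [∀ q, Module ℂ (L q)] [TopologicalSpace (TotalSpace ℂ E)] [TopologicalSpace (TotalSpace ℂ L)]
    (h : LineBundleIso E L) (n : ℤ) : IsChernNumber L n ↔ IsChernNumber E n := by
  obtain ⟨f, hf, hf'⟩ := h
  exact ⟨fun h => h.of_lineBundleIso (fun q => (f q).symm) hf', fun h => h.of_lineBundleIso f hf⟩

theorem equator_eq_inclMinus (θ : ℝ) : equator θ = inclMinus (diskBoundary θ) :=
  inclPlus_eq_inclMinus (diskRadiusSq_diskBoundary θ)

theorem diskProj_zero_zero_ne_zero {M : ℝ} (hM : 0 < M) (p : ClosedDisk) :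
    diskProj M p 0 0 ≠ 0 := by
  have h : 0 ≤ diskVec M p 2 := by simp [diskVec]; positivity
  have h2 : (1 + diskVec M p 2) / 2 ≠ 0 := by positivity
  rw [diskProj, blochProj_eq]
  simp only [Matrix.of_apply, Matrix.cons_val', Matrix.cons_val]
  exact_mod_cast h2

theorem diskProj_one_one_ne_zero {M : ℝ} (hM : M < 0) (p : ClosedDisk) :
    diskProj M p 1 1 ≠ 0 := by
  have h : 0 ≤ -diskVec M p 2 := by
    have h1 : 0 ≤ -M := by linarith
    have h2 : -diskVec M p 2 = (√(diskRadiusSq p + M ^ 2 * (1 - diskRadiusSq p)))⁻¹ *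
        (-M * √(1 - diskRadiusSq p)) := by
      simp [diskVec]
    rw [h2]
    positivity
  have h2 : (1 - diskVec M p 2) / 2 ≠ 0 := by
    have : 0 < 1 - diskVec M p 2 := by linarith
    positivity
  rw [diskProj, blochProj_eq]
  simp only [Matrix.of_apply, Matrix.cons_val', Matrix.cons_val]
  exact_mod_cast h2

theorem diskProj_diskBoundary (M θ : ℝ) :
    diskProj M (diskBoundary θ) = !![1 / 2, Complex.exp (-(θ * Complex.I)) / 2;
      Complex.exp (θ * Complex.I) / 2, 1 / 2] := by
  rw [diskProj, diskVec_of_boundary M (diskRadiusSq_diskBoundary θ), blochProj_eq, ← neg_mul,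
    Complex.exp_mul_I, Complex.exp_mul_I]
  simp [diskBoundary, sub_eq_add_neg]

theorem isChernNumber_gluedProj_one {mp mm : ℝ} (hp : 0 < mp) (hm : mm < 0) :
    IsChernNumber (BandFiber (gluedProj hp.ne' hm.ne)) 1 := by
  have hcol : ∀ i, Continuous fun q =>
      TotalSpace.mk' ℂ q (BandFiber.column (gluedProj hp.ne' hm.ne) q i) := by
    intro i
    rw [(BandFiber.isInducing_proj_vec _).continuous_iff]
    refine continuous_id.prodMk (continuous_pi fun j => ?_)
    simp only [BandFiber.vec_column]
    exact (gluedProj hp.ne' hm.ne).continuous.matrix_elem j i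
  refine ⟨fun q => BandFiber.column _ q 0, fun q => BandFiber.column _ q 1,
    (hcol 0).continuousOn, (hcol 1).continuousOn, ?_, ?_, fun θ => θ * Complex.I, by fun_prop,
    fun θ => ?_, ?_⟩
  · rintro _ ⟨p, rfl⟩
    exact BandFiber.column_ne_zero (diskProj_zero_zero_ne_zero hp p)
  · rintro _ ⟨p, rfl⟩
    exact BandFiber.column_ne_zero (diskProj_one_one_ne_zero hm p)
  · ext j
    rw [BandFiber.vec_smul, Pi.smul_apply, BandFiber.vec_column, BandFiber.vec_column, equator,
      gluedProj_inclPlus, diskProj_diskBoundary]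
    fin_cases j
    · simp [← mul_div_assoc, ← Complex.exp_add]
    · simp [div_eq_mul_inv]
  · push_cast
    ring

theorem continuous_vec_comp {X B : Type*} [TopologicalSpace X] [TopologicalSpace B] {P : B → Mat2}
    {s : ∀ q, BandFiber P q} {ι : X → B} (hι : Continuous ι)
    (hs : ContinuousOn (fun q => TotalSpace.mk' ℂ q (s q)) (Set.range ι)) (i : Fin 2) :
    Continuous fun x => (s (ι x)).vec i :=
  ((continuous_apply i).comp (BandFiber.continuous_vec P)).comp
    (hs.comp_continuous hι fun x => ⟨x, rfl⟩)

/-- Coordinate 0 of $s_+$ and coordinate 1 of $s_-$ never vanish on their disks, so they have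
periodic boundary logarithms $\alpha,\beta$. The winding of $\varphi$ is therefore that of
$i\theta$. -/
theorem IsChernNumber.eq_one {mp mm : ℝ} (hp : 0 < mp) (hm : mm < 0) {n : ℤ}
    (h : IsChernNumber (BandFiber (gluedProj hp.ne' hm.ne)) n) : n = 1 := by
  have hP := isLineProj_gluedProj hp.ne' hm.ne
  obtain ⟨sp, sm, hsp, hsm, hsp0, hsm0, φ, hφ, hs, hn⟩ := h
  obtain ⟨α, hα, hα1, hα2⟩ := exists_periodic_log (continuous_vec_comp continuous_inclPlus hsp 0)
    fun p => BandFiber.vec_apply_ne_zero (hP _) (diskProj_zero_zero_ne_zero hp p)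
      (hsp0 _ ⟨p, rfl⟩)
  obtain ⟨β, hβ, hβ1, hβ2⟩ := exists_periodic_log (continuous_vec_comp continuous_inclMinus hsm 1)
    fun p => BandFiber.vec_apply_ne_zero (hP _) (diskProj_one_one_ne_zero hm p)
      (hsm0 _ ⟨p, rfl⟩)
  have hexp : ∀ θ, Complex.exp (α θ + θ * Complex.I - φ θ - β θ) = 1 := by
    intro θ
    -- On the equator every fiber vector is a multiple of $(1,e^{i\theta})$.
    have h1 : (sp (equator θ)).vec 1 = (sp (equator θ)).vec 0 * Complex.exp (θ * Complex.I) := by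
      have hP00 : gluedProj hp.ne' hm.ne (equator θ) = _ := diskProj_diskBoundary mp θ
      rw [BandFiber.vec_apply_mul (hP _) (i := 0) (by rw [hP00]; simp) _ 1, hP00]
      simp
      ring
    have h2 : (sp (equator θ)).vec 1 = Complex.exp (φ θ) * (sm (equator θ)).vec 1 := by
      rw [hs, BandFiber.vec_smul, Pi.smul_apply, smul_eq_mul]
    have h3 : (sm (equator θ)).vec 1 = Complex.exp (β θ) := by
      rw [hβ1, equator_eq_inclMinus]
    have h4 : (sp (equator θ)).vec 0 = Complex.exp (α θ) := (hα1 θ).symm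
    rw [h1, h4, h3] at h2
    rw [Complex.exp_sub, Complex.exp_sub, Complex.exp_add, h2, div_div, div_self]
    exact mul_ne_zero (Complex.exp_ne_zero _) (Complex.exp_ne_zero _)
  have hc := eq_of_continuous_exp_eq_one (by fun_prop) hexp (2 * Real.pi) 0
  rw [hα2, hβ2] at hc
  push_cast at hc
  have h5 : 2 * (Real.pi : ℂ) * Complex.I * (n : ℂ) = 2 * (Real.pi : ℂ) * Complex.I * 1 := by
    linear_combination -hn - hc
  have h6 := mul_left_cancel₀ Complex.two_pi_I_ne_zero h5
  exact_mod_cast h6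

theorem isChernNumber_gluedProj_iff {mp mm : ℝ} (hp : 0 < mp) (hm : mm < 0) (n : ℤ) :
    IsChernNumber (BandFiber (gluedProj hp.ne' hm.ne)) n ↔ n = 1 :=
  ⟨fun h => h.eq_one hp hm, fun h => h ▸ isChernNumber_gluedProj_one hp hm⟩

end LineBundle

theorem mainTheorem1 (m : ℝ → ℝ) (mp mm : ℝ) (hm : ContDiff ℝ 1 m) (hmono : Monotone m)
    (htop : Tendsto m atTop (𝓝 mp)) (hbot : Tendsto m atBot (𝓝 mm))
    (hmp : 0 < mp) (hmm : mm < 0) :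
    -- the constant mass Hamiltonians are the asymptotic Hamiltonians
    IsAsymptoticHamiltonian (diracOp m) (diracOp fun _ => mp) atTop ∧
    IsAsymptoticHamiltonian (diracOp m) (diracOp fun _ => mm) atBot ∧
    IsFourierSymbol (diracOp fun _ => mp) (diracSymbol mp) ∧
    IsFourierSymbol (diracOp fun _ => mm) (diracSymbol mm) ∧
    -- their positive band projections
    IsBandProjection (diracSymbol mp) (dispersion mp) (bandProj mp) ∧
    IsBandProjection (diracSymbol mm) (dispersion mm) (bandProj mm) ∧
    -- the projections agree at infinity, in every direction
    (∀ θ : ℝ, ∃ L : Mat2,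
      Tendsto (fun r : ℝ => bandProj mp (r * Real.cos θ, r * Real.sin θ)) atTop (𝓝 L) ∧
      Tendsto (fun r : ℝ => bandProj mm (r * Real.cos θ, r * Real.sin θ)) atTop (𝓝 L)) ∧
    -- the formal Chern numbers
    Integrable (chernDensity (bandProj mp)) ∧
    Integrable (chernDensity (bandProj mm)) ∧
    formalChern (bandProj mp)
      = ((1 / (4 * Real.pi) * ∫ k, solidAngleDensity (blochVec mp) k : ℝ) : ℂ) ∧
    formalChern (bandProj mm)
      = ((1 / (4 * Real.pi) * ∫ k, solidAngleDensity (blochVec mm) k : ℝ) : ℂ) ∧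
    formalChern (bandProj mp) = ((1 / 2 * Real.sign mp : ℝ) : ℂ) ∧
    formalChern (bandProj mm) = ((1 / 2 * Real.sign mm : ℝ) : ℂ) ∧
    formalChern (bandProj mp) - formalChern (bandProj mm) = 1 ∧
    -- the compactified Brillouin zone is a sphere
    Nonempty (CompactBZ ≃ₜ Metric.sphere (0 : EuclideanSpace ℝ (Fin 3)) 1) ∧
    -- the glued projection, its line bundle, and its Chern number
    ∃ P : C(CompactBZ, Mat2),
      (∀ k, P (inclPlus (toDisk k)) = bandProj mp k) ∧
      (∀ k, P (inclMinus (toDisk k)) = bandProj mm k) ∧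
      (∀ P' : C(CompactBZ, Mat2), (∀ k, P' (inclPlus (toDisk k)) = bandProj mp k) →
        (∀ k, P' (inclMinus (toDisk k)) = bandProj mm k) → P' = P) ∧
      (∀ q, IsLineProj (P q)) ∧
      (∃ _ : FiberBundle ℂ (BandFiber P), VectorBundle ℂ ℂ (BandFiber P)) ∧
      chernIntegral P = formalChern (bandProj mp) - formalChern (bandProj mm) ∧
      (∀ n : ℤ, IsChernNumber (BandFiber P) n ↔
        (n : ℂ) = formalChern (bandProj mp) - formalChern (bandProj mm)) ∧
      (∀ (L : CompactBZ → Type) [∀ q, AddCommGroup (L q)] [∀ q, Module ℂ (L q)]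
        [TopologicalSpace (TotalSpace ℂ L)], LineBundleIso (BandFiber P) L →
        ∀ n : ℤ, IsChernNumber L n ↔
          (n : ℂ) = formalChern (bandProj mp) - formalChern (bandProj mm)) := by
  have hmp' := hmp.ne'
  have hmm' := hmm.ne
  -- Monotonicity confines $m$ to $[m_-,m_+]$, which gives the uniform bound needed for domination
  -- at both ends.
  have hC : ∀ c ∈ Set.Icc mm mp, ∀ x, |m x - c| ≤ mp - mm := fun c hc x => by
    have h1 := hmono.ge_of_tendsto htop x
    have h2 := hmono.le_of_tendsto hbot x
    rw [abs_le]
    constructor <;> linarith [hc.1, hc.2]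
  have hle : mm ≤ mp := hmm.le.trans hmp.le
  have hdiff : formalChern (bandProj mp) - formalChern (bandProj mm) = 1 := by
    rw [formalChern_bandProj hmp', formalChern_bandProj hmm', Real.sign_of_pos hmp,
      Real.sign_of_neg hmm]
    norm_num
  have hiff : ∀ n : ℤ, IsChernNumber (BandFiber (gluedProj hmp' hmm')) n ↔
      (n : ℂ) = formalChern (bandProj mp) - formalChern (bandProj mm) := fun n => by
    rw [isChernNumber_gluedProj_iff hmp hmm, hdiff]
    norm_cast
  refine ⟨isAsymptoticHamiltonian_diracOp hm.continuous (hC mp ⟨hle, le_rfl⟩) htop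
      fun s => tendsto_atTop_add_const_left _ s tendsto_id,
    isAsymptoticHamiltonian_diracOp hm.continuous (hC mm ⟨le_rfl, hle⟩) hbot
      fun s => tendsto_atBot_add_const_left _ s tendsto_id,
    isFourierSymbol_diracOp mp, isFourierSymbol_diracOp mm,
    isBandProjection_bandProj hmp', isBandProjection_bandProj hmm',
    fun θ => ⟨_, tendsto_bandProj_radial hmp' θ, tendsto_bandProj_radial hmm' θ⟩,
    integrable_chernDensity_bandProj hmp', integrable_chernDensity_bandProj hmm',
    formalChern_bandProj_eq_integral hmp', formalChern_bandProj_eq_integral hmm',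
    formalChern_bandProj hmp', formalChern_bandProj hmm', hdiff,
    nonempty_homeomorph_sphere, gluedProj hmp' hmm',
    fun k => diskProj_toDisk mp k, fun k => diskProj_toDisk mm k, fun P' h1 h2 => ?_,
    isLineProj_gluedProj hmp' hmm',
    exists_vectorBundle_band (gluedProj hmp' hmm').continuous (isLineProj_gluedProj hmp' hmm'),
    chernIntegral_gluedProj hmp' hmm', hiff, ?_⟩
  · exact continuousMap_compactBZ_ext (fun k => (h1 k).trans (diskProj_toDisk mp k).symm)
      fun k => (h2 k).trans (diskProj_toDisk mm k).symm
  · intro L _ _ _ hL n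
    rw [hL.isChernNumber_iff, hiff]
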